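/- Let $d\in\{2,3\}$, let $\Omega\subset\mathbb{R}^d$ be a bounded open set with Lipschitz boundary, and let $\mathcal P$ be a conforming partition of $\Omega$ into finitely many simplices or affine quadrilaterals/hexahedra. Let $T>0$, $N\ge 1$, $\Delta t=T/N$, $t_n=n\Delta t$, and let $\varepsilon>0$, $\mu\ge 0$, $\gamma\ge 0$, $\alpha>0$. Let $\kappa>0$ on $[0,T]$. For $1\le n\le N$ let $\beta(t_n)\in W^{1,\infty}(\Omega)^d$ (continuous representative on $\overline\Omega$) with $\operatorname{div}\beta(t_n)=0$, and let $f^n=f(t_n)\in L^2(\Omega)$ for $0\le n\le N$. Let $u^0\in C^0(\overline\Omega)\cap H^1_0(\Omega)$ with $0\le u^0\le\kappa(0)$ in $\Omega$. For $k\ge 1$ let $V_{\mathcal P}=\{v\in C^0(\overline\Omega): v|_K\in\mathfrak R(K)\ \forall K\in\mathcal P\}\cap H^1_0(\Omega)$, where $\mathfrak R(K)=\mathbb P_k(K)$ for simplices and $\mathfrak R(K)=\mathbb Q_k(K)$ (mapped) for quadrilaterals/hexahedra. Let $x_i$ be the internal Lagrange nodes, $\phi_i\in V_{\mathcal P}$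 the Lagrange basis functions, $i_hv=\sum_i v(x_i)\phi_i$, and for $v\in V_{\mathcal P}$ at time $t$ let $$v^+=\sum_i\max\{0,\min\{v(x_i),\kappa(t)\}\}\phi_i,\qquad v^-=v-v^+ .$$ With $h_G$ the diameter of $G$, $\mathcal F_I$ the set of internal facets, $[\![\cdot]\!]$ the jump across a facet, $\omega_i$ the union of the cells containing $x_i$, and $\mathfrak h$ the continuous element-wise linear function (multilinear in reference coordinates on quadrilaterals/hexahedra) whose value at each vertex is the average of $h_K$ over the cells $K$ containing it, put, at time $t_n$ (with $\beta=\beta(t_n)$), $$a(w,v)=\varepsilon(\nabla w,\nabla v)_\Omega+(\beta\cdot\nabla w,v)_\Omega+\mu(w,v)_\Omega,$$ $$J(w,v)=\gamma\sum_{F\in\mathcal F_I}\int_F\|\beta\|_{0,\infty,F}\,h_F^2\,[\![\nabla w]\!]\cdot[\![\nabla v]\!]\,ds,$$ $$s(w,v)=\alpha\sum_i\Big(\varepsilon\,\mathfrak h(x_i)^{d-2}+\|\beta\|_{0,\infty,\omega_i}\mathfrak h(x_i)^{d-1}+\big(\tfrac1{\Delta t}+\mu\big)\mathfrak h(x_i)^d\Big)w(x_i)v(x_i).$$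 Let $u_h^0=i_hu^0$ and let $u_h^n\in V_{\mathcal P}$, $n=1,\dots,N$, solve the implicit Euler bound-preserving scheme $$\Big(\frac{(u_h^n)^+-(u_h^{n-1})^+}{\Delta t},v_h\Big)_\Omega+a((u_h^n)^+,v_h)+J((u_h^n)^+,v_h)+s((u_h^n)^-,v_h)=(f^n,v_h)_\Omega\qquad\forall v_h\in V_{\mathcal P},$$ where $(u_h^n)^\pm$ is taken at time $t_n$. Then $$\max_{1\le m\le N}\|(u_h^m)^+\|_{0,\Omega}^2+2\Delta t\sum_{n=1}^N\Big(\varepsilon|(u_h^n)^+|_{1,\Omega}^2+\mu\|(u_h^n)^+\|_{0,\Omega}^2+J((u_h^n)^+,(u_h^n)^+)\Big)\le e^2\Big(\|u_h^0\|_{0,\Omega}^2+\Delta t\,T\sum_{n=0}^N\|f^n\|_{0,\Omega}^2\Big),$$ where $J$ in the $n$-th summand is taken with $\beta=\beta(t_n)$. -/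

import Mathlib

open MeasureTheory Filter Topology
open scoped ContDiff NNReal ENNReal

namespace BPFem

noncomputable section

/-! ### Function spaces on an open set of Euclidean space -/

/-- The Euclidean space `ℝ^d`. -/
abbrev E (d : ℕ) : Type := EuclideanSpace ℝ (Fin d)

/-- `Ω` is a Lipschitz domain: near every boundary point, after a rotation, it is the set of
points strictly above the graph of a Lipschitz function. The graph direction is the unit
vector `ν`, and `g` is evaluated at the orthogonal projection of `y` on the hyperplane `ν^⊥`. -/
def IsLipschitzDomain {d : ℕ} (Ω : Set (E d)) : Prop :=
  ∀ x ∈ frontier Ω, ∃ (ν : E d) (r : ℝ) (L : ℝ≥0) (g : E d → ℝ),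
    ‖ν‖ = 1 ∧ 0 < r ∧ LipschitzWith L g ∧
      ∀ y ∈ Metric.ball x r, (y ∈ Ω ↔ g (y - inner ℝ ν y • ν) < inner ℝ ν y)

/-- Test functions: smooth, with compact support contained in `Ω`. -/
def IsTestFunction {d : ℕ} (Ω : Set (E d)) (φ : E d → ℝ) : Prop :=
  ContDiff ℝ ∞ φ ∧ HasCompactSupport φ ∧ tsupport φ ⊆ Ω

/-- `g` is a weak gradient of `v` in `Ω`. -/
def IsWeakGradient {d : ℕ} (Ω : Set (E d)) (v : E d → ℝ) (g : E d → E d) : Prop :=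
  LocallyIntegrableOn v Ω volume ∧ LocallyIntegrableOn g Ω volume ∧
    ∀ φ : E d → ℝ, IsTestFunction Ω φ →
      ∫ x in Ω, v x • gradient φ x = -∫ x in Ω, φ x • g x

open Classical in
/-- The weak gradient `∇v` in `Ω` (unique almost everywhere in `Ω`). -/
def weakGradient {d : ℕ} (Ω : Set (E d)) (v : E d → ℝ) : E d → E d :=
  if h : ∃ g, IsWeakGradient Ω v g then h.choose else 0

/-- `v ∈ H¹(Ω)`. -/
def MemH1 {d : ℕ} (Ω : Set (E d)) (v : E d → ℝ) : Prop :=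
  MemLp v 2 (volume.restrict Ω) ∧
    ∃ g : E d → E d, IsWeakGradient Ω v g ∧ MemLp g 2 (volume.restrict Ω)

/-- `v ∈ H¹₀(Ω)`, the closure of the test functions in `H¹(Ω)`. -/
def MemH10 {d : ℕ} (Ω : Set (E d)) (v : E d → ℝ) : Prop :=
  MemH1 Ω v ∧ ∃ φ : ℕ → E d → ℝ, (∀ j, IsTestFunction Ω (φ j)) ∧
    Tendsto (fun j => eLpNorm (fun x => φ j x - v x) 2 (volume.restrict Ω)) atTop (𝓝 0) ∧
    Tendsto (fun j => eLpNorm (fun x => gradient (φ j) x - weakGradient Ω v x) 2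
      (volume.restrict Ω)) atTop (𝓝 0)

/-- `b ∈ W^{1,∞}(Ω)^d`. -/
def MemW1Inf {d : ℕ} (Ω : Set (E d)) (b : E d → E d) : Prop :=
  MemLp b ⊤ (volume.restrict Ω) ∧
    ∀ i : Fin d, ∃ g : E d → E d,
      IsWeakGradient Ω (fun x => b x i) g ∧ MemLp g ⊤ (volume.restrict Ω)

/-- `div b = 0` in `Ω` (in the sense of distributions). -/
def IsDivFree {d : ℕ} (Ω : Set (E d)) (b : E d → E d) : Prop :=
  ∀ φ : E d → ℝ, IsTestFunction Ω φ → ∫ x in Ω, inner ℝ (b x) (gradient φ x) = 0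

/-- The inner product `(v, w)_Ω` of `L²(Ω)`. -/
def l2Inner {d : ℕ} (Ω : Set (E d)) (v w : E d → ℝ) : ℝ := ∫ x in Ω, v x * w x

/-- The inner product `(g, h)_Ω` of `L²(Ω)^d`. -/
def l2InnerVec {d : ℕ} (Ω : Set (E d)) (g h : E d → E d) : ℝ := ∫ x in Ω, inner ℝ (g x) (h x)

/-- The norm `‖v‖_{0,Ω}` of `L²(Ω)`. -/
def l2Norm {d : ℕ} (Ω : Set (E d)) (v : E d → ℝ) : ℝ := √(l2Inner Ω v v)

/-- The seminorm `|v|_{1,Ω}` of `H¹(Ω)`. -/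
def h1Seminorm {d : ℕ} (Ω : Set (E d)) (v : E d → ℝ) : ℝ :=
  √(l2InnerVec Ω (weakGradient Ω v) (weakGradient Ω v))

/-- The norm `‖b‖_{0,∞,G}` for the measure `ν` carried by `G`. -/
def supNorm {d : ℕ} (ν : Measure (E d)) (b : E d → E d) : ℝ := (eLpNorm b ⊤ ν).toReal

/-! ### Cells -/

/-- The two kinds of mesh cells. -/
inductive CellShape where
  | simplex : CellShape
  | cube : CellShape

/-- The reference cell: the unit simplex or the unit cube. -/
def CellShape.refCell (d : ℕ) : CellShape → Set (E d)
  | .simplex => {x | (∀ i, 0 ≤ x i) ∧ ∑ i, x i ≤ 1}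
  | .cube => {x | ∀ i, 0 ≤ x i ∧ x i ≤ 1}

/-- Polynomials on the reference cell: total degree at most `k` on the simplex, degree at most
`k` in each variable on the cube. -/
def CellShape.polySpace (d k : ℕ) : CellShape → Submodule ℝ (MvPolynomial (Fin d) ℝ)
  | .simplex => MvPolynomial.restrictTotalDegree (Fin d) ℝ k
  | .cube => MvPolynomial.restrictDegree (Fin d) ℝ k

/-- Multi-indices of the Lagrange nodes of order `k`. -/
def CellShape.nodeIndices (d k : ℕ) : CellShape → Finset (Fin d → ℕ)
  | .simplex => (Fintype.piFinset fun _ => Finset.range (k + 1)).filter fun a => ∑ i, a i ≤ k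
  | .cube => Fintype.piFinset fun _ => Finset.range (k + 1)

/-- The Lagrange node of order `k` with multi-index `a` in the reference cell: the point `a/k`. -/
def refNode (d k : ℕ) (a : Fin d → ℕ) : E d := WithLp.toLp 2 fun i => (a i : ℝ) / k

/-- The lowest order shape function on the reference cell attached to the vertex `a`
(a multi-index with entries in `{0,1}`): the barycentric coordinate on the simplex, the
multilinear shape function on the cube. -/
def CellShape.vertexShape (d : ℕ) (a : Fin d → ℕ) (x : E d) : CellShape → ℝ
  | .simplex => if a = 0 then 1 - ∑ i, x i else ∑ i, (a i : ℝ) * x i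
  | .cube => ∏ i, if a i = 0 then 1 - x i else x i

/-- A cell: a simplex or an affine quadrilateral/hexahedron, given as the image of the
reference cell under an invertible affine map. -/
structure Cell (d : ℕ) where
  shape : CellShape
  map : E d ≃ᵃ[ℝ] E d

/-- The (closed) cell as a set of points. -/
def Cell.carrier {d : ℕ} (K : Cell d) : Set (E d) := K.map '' K.shape.refCell d

/-- The diameter `h_K`. -/
def Cell.diam {d : ℕ} (K : Cell d) : ℝ := Metric.diam K.carrier

open Classical in
/-- The Lagrange nodes of order `k` of a cell. For `k = 1` these are its vertices. -/
def Cell.nodes {d : ℕ} (K : Cell d) (k : ℕ) : Finset (E d) :=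
  (K.shape.nodeIndices d k).image fun a => K.map (refNode d k a)

/-- The restriction of `v` to `K` is in the local space: `ℙ_k(K)` on simplices, the mapped
space `ℚ_k(K)` on affine quadrilaterals/hexahedra. -/
def Cell.IsLocalPoly {d : ℕ} (K : Cell d) (k : ℕ) (v : E d → ℝ) : Prop :=
  ∃ p ∈ K.shape.polySpace d k, ∀ x ∈ K.carrier,
    v x = MvPolynomial.eval (fun i => K.map.symm x i) p

/-! ### Meshes -/

/-- A conforming partition of `Ω` into finitely many cells: the cells cover the closure of `Ω`,
they are pairwise different, and the intersection of any two of them is empty or a common face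
of both (for polytopes, the faces are the exposed faces; as the cells have non-empty interior,
different cells then have disjoint interiors). -/
structure Mesh (d : ℕ) (Ω : Set (E d)) where
  size : ℕ
  cell : Fin size → Cell d
  cover : ⋃ i, (cell i).carrier = closure Ω
  distinct : Function.Injective fun i => (cell i).carrier
  conforming : ∀ i j, IsExposed ℝ (cell i).carrier ((cell i).carrier ∩ (cell j).carrier)

namespace Mesh

variable {d : ℕ} {Ω : Set (E d)}

/-- The finite element space `V_P`. -/
def feSpace (P : Mesh d Ω) (k : ℕ) : Set (E d → ℝ) :=
  {v | ContinuousOn v (closure Ω) ∧ (∀ i, (P.cell i).IsLocalPoly k v) ∧ MemH10 Ω v}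

open Classical in
/-- The internal nodes: the Lagrange nodes that are not on the boundary of `Ω`. -/
def internalNodes (P : Mesh d Ω) (k : ℕ) : Finset (E d) :=
  (Finset.univ.biUnion fun i => (P.cell i).nodes k).filter fun x => x ∈ Ω

open Classical in
/-- The Lagrange basis function of the internal node `x`: the function of `V_P` (unique on
the closure of `Ω`) that is `1` at `x` and `0` at the other internal nodes. -/
def lagrangeBasis (P : Mesh d Ω) (k : ℕ) (x : E d) : E d → ℝ :=
  if h : ∃ φ ∈ P.feSpace k, ∀ y ∈ P.internalNodes k, φ y = if y = x then 1 else 0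
  then h.choose else 0

/-- The Lagrange interpolation operator `i_h`. -/
def interp (P : Mesh d Ω) (k : ℕ) (v : E d → ℝ) : E d → ℝ :=
  fun y => ∑ x ∈ P.internalNodes k, v x * P.lagrangeBasis k x y

/-- The constrained part `v⁺` of `v` for the upper bound `κ`. -/
def constrained (P : Mesh d Ω) (k : ℕ) (κ : ℝ) (v : E d → ℝ) : E d → ℝ :=
  fun y => ∑ x ∈ P.internalNodes k, max 0 (min (v x) κ) * P.lagrangeBasis k x y

/-- The complementary part `v⁻ = v - v⁺`. -/
def complementary (P : Mesh d Ω) (k : ℕ) (κ : ℝ) (v : E d → ℝ) : E d → ℝ :=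
  fun y => v y - P.constrained k κ v y

open Classical in
/-- The value of the mesh function at a vertex `y`: the average of the diameters of the cells
that contain `y`. -/
def vertexDiam (P : Mesh d Ω) (y : E d) : ℝ :=
  (∑ i with y ∈ (P.cell i).carrier, (P.cell i).diam) /
    (Finset.univ.filter fun i => y ∈ (P.cell i).carrier).card

open Classical in
/-- The mesh function `𝔥`: the continuous, element-wise linear (multilinear in reference
coordinates on quadrilaterals/hexahedra) function with the vertex values `vertexDiam`. It is
evaluated in a cell containing `x`; as the mesh is conforming, the value does not depend on the
choice of the cell. -/
def meshFun (P : Mesh d Ω) (x : E d) : ℝ :=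
  if h : ∃ i, x ∈ (P.cell i).carrier then
    let K := P.cell h.choose
    ∑ a ∈ K.shape.nodeIndices d 1,
      K.shape.vertexShape d a (K.map.symm x) * P.vertexDiam (K.map (refNode d 1 a))
  else 0

/-- The patch `ω_x`: the union of the cells that contain `x`. -/
def patch (P : Mesh d Ω) (x : E d) : Set (E d) :=
  ⋃ (i) (_ : x ∈ (P.cell i).carrier), (P.cell i).carrier

/-- The common facet of two cells (if they share a facet). -/
def facet (P : Mesh d Ω) (i j : Fin P.size) : Set (E d) := (P.cell i).carrier ∩ (P.cell j).carrier

open Classical in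
/-- The internal facets, each represented by the pair `i < j` of the two cells that share it:
the common face has dimension `d - 1`. -/
def internalFacets (P : Mesh d Ω) : Finset (Fin P.size × Fin P.size) :=
  Finset.univ.filter fun p =>
    p.1 < p.2 ∧ Module.finrank ℝ (vectorSpan ℝ (P.facet p.1 p.2)) + 1 = d

/-- The jump of the gradient of a piecewise smooth function across the facet shared by the cells
`i` and `j`. -/
def gradJump (P : Mesh d Ω) (i j : Fin P.size) (v : E d → ℝ) (x : E d) : E d :=
  gradientWithin v (P.cell i).carrier x - gradientWithin v (P.cell j).carrier x

/-- Surface measure on the facet shared by the cells `i` and `j`. -/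
def facetMeasure (P : Mesh d Ω) (i j : Fin P.size) : Measure (E d) :=
  (Measure.euclideanHausdorffMeasure (d - 1)).restrict (P.facet i j)

/-- The continuous interior penalty form `J` for the convective field `b`. -/
def J (P : Mesh d Ω) (γ : ℝ) (b : E d → E d) (v w : E d → ℝ) : ℝ :=
  γ * ∑ p ∈ P.internalFacets,
    ∫ x, supNorm (P.facetMeasure p.1 p.2) b * Metric.diam (P.facet p.1 p.2) ^ 2 *
      inner ℝ (P.gradJump p.1 p.2 v x) (P.gradJump p.1 p.2 w x) ∂(P.facetMeasure p.1 p.2)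

/-- The stabilising form `s`, with time step `Δt` and convective field `b`. -/
def s (P : Mesh d Ω) (k : ℕ) (α ε μ Δt : ℝ) (b : E d → E d) (v w : E d → ℝ) : ℝ :=
  α * ∑ x ∈ P.internalNodes k,
    (ε * P.meshFun x ^ (d - 2)
      + supNorm (volume.restrict (P.patch x)) b * P.meshFun x ^ (d - 1)
      + (1 / Δt + μ) * P.meshFun x ^ d) * v x * w x

end Mesh

/-- The bilinear form `a` for the convective field `b`. -/
def aForm {d : ℕ} (Ω : Set (E d)) (ε μ : ℝ) (b : E d → E d) (v w : E d → ℝ) : ℝ :=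
  ε * l2InnerVec Ω (weakGradient Ω v) (weakGradient Ω w)
    + l2Inner Ω (fun x => inner ℝ (b x) (weakGradient Ω v x)) w
    + μ * l2Inner Ω v w

/-- The sequence `u 0, …, u N` solves the bound-preserving implicit Euler scheme on `[0, T]` with
`N` time steps of size `T / N`; here `(u n)⁺` is the constrained part for the bound
`κ (t_n)`, with `t_n = n T / N`. -/
def SolvesEuler {d : ℕ} {Ω : Set (E d)} (P : Mesh d Ω) (k N : ℕ) (T ε μ γ α : ℝ)
    (κ : ℝ → ℝ) (β : ℝ → E d → E d) (f : ℝ → E d → ℝ) (u0 : E d → ℝ)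
    (u : ℕ → E d → ℝ) : Prop :=
  let Δt : ℝ := T / N
  let t : ℕ → ℝ := fun n => n * Δt
  let up : ℕ → E d → ℝ := fun n => P.constrained k (κ (t n)) (u n)
  let um : ℕ → E d → ℝ := fun n => P.complementary k (κ (t n)) (u n)
  Set.EqOn (u 0) (P.interp k u0) (closure Ω) ∧
    ∀ n ∈ Finset.Icc 1 N, u n ∈ P.feSpace k ∧
      ∀ v ∈ P.feSpace k,
        l2Inner Ω (fun x => (up n x - up (n - 1) x) / Δt) v
          + (aForm Ω ε μ (β (t n)) (up n) v + P.J γ (β (t n)) (up n) v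
            + P.s k α ε μ Δt (β (t n)) (um n) v)
          = l2Inner Ω (f (t n)) v

end

end BPFem

namespace BPFem

variable {d : ℕ} {Ω : Set (E d)}

/-! ### Weak gradients -/

/-! The proof tests the scheme at time $t_n$ with $v_h=(u_h^n)^+$, which is admissible because it is
a combination of basis functions in $V_{\mathcal P}$. The convective term then vanishes
(`l2Inner_convection_self_eq_zero`): for a test function $\varphi$,
$(\beta\cdot\nabla\varphi,\varphi)=\frac12\int\beta\cdot\nabla(\varphi^2)=0$, and this passes to the
limit in $H^1_0$ since $\beta$ is bounded. The form $J$ is nonnegative on the diagonal, and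
$s((u_h^n)^-,(u_h^n)^+)\ge 0$, because at every node the excess $u^-$ is either multiplied by
$u^+=0$ or nonnegative (`Mesh.s_complementary_constrained_nonneg`).

Write $A_n=\|(u_h^n)^+\|$, $F_n=\|f^n\|$, $\tau=\Delta t$, and $D_n$ for the $n$-th dissipation
term. Cauchy–Schwarz leaves $A_n^2+\tau D_n\le A_{n-1}A_n+\tau F_nA_n$. The rest concerns real
sequences (`sq_add_sum_le_of_energy_step`) and needs no Gronwall lemma. Cancelling $A_n$ bounds
every $A_m$ by $A_0+\tau\sum F_n$; inserting this bound in the source term and telescoping controls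
the dissipation. The resulting constant is $5$, which is below $e^2$. Finally $A_0=\|u_h^0\|$,
because truncation does not alter an interpolant of admissible data. -/

theorem IsTestFunction.continuous_gradient {φ : E d → ℝ} (hφ : IsTestFunction Ω φ) :
    Continuous (gradient φ) :=
  (InnerProductSpace.toDual ℝ (E d)).symm.continuous.comp (hφ.1.continuous_fderiv (by simp))

theorem IsTestFunction.tsupport_gradient_subset {φ : E d → ℝ} :
    tsupport (gradient φ) ⊆ tsupport φ := by
  refine closure_minimal (fun x hx => ?_) (isClosed_tsupport φ)
  refine support_fderiv_subset ℝ (f := φ) fun h0 => hx ?_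
  simp [gradient, h0]

theorem IsTestFunction.hasCompactSupport_gradient {φ : E d → ℝ} (hφ : IsTestFunction Ω φ) :
    HasCompactSupport (gradient φ) :=
  hφ.2.1.of_isClosed_subset (isClosed_tsupport _) IsTestFunction.tsupport_gradient_subset

theorem IsTestFunction.memLp {φ : E d → ℝ} (hφ : IsTestFunction Ω φ) (p : ℝ≥0∞) :
    MemLp φ p (volume.restrict Ω) :=
  (hφ.1.continuous.memLp_of_hasCompactSupport hφ.2.1).restrict Ω

theorem IsTestFunction.memLp_gradient {φ : E d → ℝ} (hφ : IsTestFunction Ω φ) (p : ℝ≥0∞) :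
    MemLp (gradient φ) p (volume.restrict Ω) :=
  (hφ.continuous_gradient.memLp_of_hasCompactSupport hφ.hasCompactSupport_gradient).restrict Ω

theorem IsTestFunction.zero : IsTestFunction Ω (fun _ : E d => (0 : ℝ)) :=
  ⟨contDiff_const, HasCompactSupport.zero, by
    rw [show (fun _ : E d => (0 : ℝ)) = 0 from rfl, tsupport_zero]; exact Set.empty_subset _⟩

theorem IsTestFunction.smul_add {φ ψ : E d → ℝ} (hφ : IsTestFunction Ω φ)
    (hψ : IsTestFunction Ω ψ) (c : ℝ) : IsTestFunction Ω (fun x => c * φ x + ψ x) := by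
  have h1 : HasCompactSupport fun x => c * φ x := hφ.2.1.mul_left (f := fun _ => c)
  have h2 : tsupport (fun x => c * φ x) ⊆ tsupport φ :=
    tsupport_mul_subset_right (f := fun _ => c)
  refine ⟨(contDiff_const.mul hφ.1).add hψ.1, h1.add hψ.2.1, ?_⟩
  exact (tsupport_add (fun x => c * φ x) ψ).trans (Set.union_subset (h2.trans hφ.2.2) hψ.2.2)

theorem IsTestFunction.sq {φ : E d → ℝ} (hφ : IsTestFunction Ω φ) :
    IsTestFunction Ω (fun x => φ x * φ x) :=
  ⟨hφ.1.mul hφ.1, hφ.2.1.mul_left (f := φ), (tsupport_mul_subset_left (f := φ)).trans hφ.2.2⟩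

theorem gradient_smul_add {φ ψ : E d → ℝ} (hφ : Differentiable ℝ φ) (hψ : Differentiable ℝ ψ)
    (c : ℝ) (x : E d) :
    gradient (fun x => c * φ x + ψ x) x = c • gradient φ x + gradient ψ x := by
  have : fderiv ℝ (fun x => c * φ x + ψ x) x = c • fderiv ℝ φ x + fderiv ℝ ψ x := by
    rw [fderiv_fun_add ((hφ x).const_mul c) (hψ x), fderiv_const_mul (hφ x)]
  simp [gradient, this]

theorem gradient_sq {φ : E d → ℝ} (hφ : Differentiable ℝ φ) (x : E d) :
    gradient (fun x => φ x * φ x) x = (2 * φ x) • gradient φ x := by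
  have : fderiv ℝ (fun x => φ x * φ x) x = (2 * φ x) • fderiv ℝ φ x := by
    rw [fderiv_fun_mul (hφ x) (hφ x), ← add_smul, two_mul]
  simp [gradient, this]

/-- The compact support of `φ` lies in `Ω`, so local integrability of `g` is enough, and the product
is integrable on the whole space. -/
theorem integrableOn_smul_of_tsupport_subset {F : Type*} [NormedAddCommGroup F] [NormedSpace ℝ F]
    {φ : E d → ℝ} {g : E d → F} (hg : LocallyIntegrableOn g Ω volume)
    (hφ : Continuous φ) (hφc : HasCompactSupport φ) (hφΩ : tsupport φ ⊆ Ω) :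
    Integrable (fun x => φ x • g x) volume := by
  have h1 : IntegrableOn g (tsupport φ) := (hg.mono_set hφΩ).integrableOn_isCompact hφc
  have h2 : IntegrableOn (fun x => φ x • g x) (tsupport φ) :=
    h1.continuousOn_smul hφ.continuousOn hφc
  refine (integrableOn_iff_integrable_of_support_subset fun x hx => subset_tsupport φ ?_).1 h2
  intro h0
  exact hx (by simp [h0])

theorem integrableOn_smul_of_tsupport_subset' {F : Type*} [NormedAddCommGroup F]
    [NormedSpace ℝ F] [SecondCountableTopology F]
    {φ : E d → F} {v : E d → ℝ} (hv : LocallyIntegrableOn v Ω volume)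
    (hφ : Continuous φ) (hφc : HasCompactSupport φ) (hφΩ : tsupport φ ⊆ Ω) :
    Integrable (fun x => v x • φ x) volume := by
  have h1 : IntegrableOn v (tsupport φ) := (hv.mono_set hφΩ).integrableOn_isCompact hφc
  have h2 : IntegrableOn (fun x => v x • φ x) (tsupport φ) :=
    h1.smul_continuousOn hφ.continuousOn hφc
  refine (integrableOn_iff_integrable_of_support_subset fun x hx => subset_tsupport φ ?_).1 h2
  intro h0
  exact hx (by simp [h0])

theorem IsWeakGradient.smul_add {v w : E d → ℝ} {g h : E d → E d} (hv : IsWeakGradient Ω v g)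
    (hw : IsWeakGradient Ω w h) (c : ℝ) :
    IsWeakGradient Ω (fun x => c * v x + w x) (fun x => c • g x + h x) := by
  refine ⟨(hv.1.smul c).add hw.1, (hv.2.1.smul c).add hw.2.1, fun φ hφ => ?_⟩
  have hc := hφ.1.continuous
  have hs := IsTestFunction.tsupport_gradient_subset.trans hφ.2.2
  have i1 := (integrableOn_smul_of_tsupport_subset' hv.1 hφ.continuous_gradient
    hφ.hasCompactSupport_gradient hs).restrict (s := Ω)
  have i2 := (integrableOn_smul_of_tsupport_subset' hw.1 hφ.continuous_gradient
    hφ.hasCompactSupport_gradient hs).restrict (s := Ω)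
  have i3 := (integrableOn_smul_of_tsupport_subset hv.2.1 hc hφ.2.1 hφ.2.2).restrict (s := Ω)
  have i4 := (integrableOn_smul_of_tsupport_subset hw.2.1 hc hφ.2.1 hφ.2.2).restrict (s := Ω)
  simp only [add_smul, mul_smul, _root_.smul_add, smul_comm _ c]
  rw [integral_add (f := fun x => c • v x • gradient φ x) (i1.smul c) i2,
    integral_add (f := fun x => c • φ x • g x) (i3.smul c) i4, integral_smul, integral_smul,
    hv.2.2 φ hφ, hw.2.2 φ hφ, neg_add, smul_neg]

/-- This is the fundamental lemma of the calculus of variations applied to `g - h`. It makes the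
arbitrary choice inside `weakGradient` harmless. -/
theorem IsWeakGradient.ae_eq (hΩ : IsOpen Ω) {v : E d → ℝ} {g h : E d → E d}
    (hg : IsWeakGradient Ω v g) (hh : IsWeakGradient Ω v h) :
    g =ᵐ[volume.restrict Ω] h := by
  have key := hΩ.ae_eq_zero_of_integral_contDiff_smul_eq_zero (μ := volume)
    (hg.2.1.sub hh.2.1) fun φ h1 h2 h3 => by
      have hφ : IsTestFunction Ω φ := ⟨h1, h2, h3⟩
      have i3 := (integrableOn_smul_of_tsupport_subset hg.2.1 h1.continuous h2 h3)
      have i4 := (integrableOn_smul_of_tsupport_subset hh.2.1 h1.continuous h2 h3)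
      have e := (hg.2.2 φ hφ).symm.trans (hh.2.2 φ hφ)
      have hsub : ∀ k : E d → E d, Function.support (fun x => φ x • k x) ⊆ Ω := fun k x hx =>
        h3 (subset_tsupport φ fun h0 => hx (by simp [h0]))
      -- The integrands vanish off `Ω`, so the integrals over `Ω` become integrals over the whole
      -- space, the form used by the fundamental lemma.
      rw [setIntegral_eq_integral_of_forall_compl_eq_zero
          (fun x hx => Function.notMem_support.1 fun h => hx (hsub g h)),
        setIntegral_eq_integral_of_forall_compl_eq_zero
          (fun x hx => Function.notMem_support.1 fun h' => hx (hsub h h'))] at e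
      simp only [Pi.sub_apply, smul_sub]
      rw [integral_sub i3 i4, neg_injective e, sub_self]
  rw [Filter.EventuallyEq, ae_restrict_iff' hΩ.measurableSet]
  filter_upwards [key] with x hx hxΩ
  exact sub_eq_zero.1 (hx hxΩ)

theorem IsWeakGradient.weakGradient {v : E d → ℝ} {g : E d → E d} (hg : IsWeakGradient Ω v g) :
    IsWeakGradient Ω v (weakGradient Ω v) := by
  have h : ∃ g, IsWeakGradient Ω v g := ⟨g, hg⟩
  rw [BPFem.weakGradient, dif_pos h]
  exact h.choose_spec

theorem MemH1.isWeakGradient {v : E d → ℝ} (hv : MemH1 Ω v) :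
    IsWeakGradient Ω v (weakGradient Ω v) :=
  let ⟨_, hg, _⟩ := hv.2
  hg.weakGradient

theorem MemH1.memLp_weakGradient (hΩ : IsOpen Ω) {v : E d → ℝ} (hv : MemH1 Ω v) :
    MemLp (weakGradient Ω v) 2 (volume.restrict Ω) :=
  let ⟨_, hg, hg2⟩ := hv.2
  (memLp_congr_ae (hg.ae_eq hΩ hg.weakGradient)).1 hg2

/-- Membership in $H^1_0$ may be checked with any square integrable weak gradient in place of the
chosen one, since the two agree a.e. -/
theorem MemH10.of_tendsto (hΩ : IsOpen Ω) {v : E d → ℝ} {g : E d → E d}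
    (hv : MemLp v 2 (volume.restrict Ω)) (hg : IsWeakGradient Ω v g)
    (hg2 : MemLp g 2 (volume.restrict Ω)) {φ : ℕ → E d → ℝ} (hφ : ∀ j, IsTestFunction Ω (φ j))
    (h1 : Tendsto (fun j => eLpNorm (fun x => φ j x - v x) 2 (volume.restrict Ω)) atTop (𝓝 0))
    (h2 : Tendsto (fun j => eLpNorm (fun x => gradient (φ j) x - g x) 2
      (volume.restrict Ω)) atTop (𝓝 0)) : MemH10 Ω v := by
  refine ⟨⟨hv, g, hg, hg2⟩, φ, hφ, h1, ?_⟩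
  refine h2.congr fun j => eLpNorm_congr_ae ?_
  filter_upwards [hg.ae_eq hΩ hg.weakGradient] with x hx
  rw [hx]

theorem MemH10.zero (hΩ : IsOpen Ω) : MemH10 Ω (fun _ : E d => (0 : ℝ)) := by
  have hgrad : ∀ x, gradient (fun _ : E d => (0 : ℝ)) x = 0 := fun x => by simp [gradient]
  refine MemH10.of_tendsto hΩ (g := fun _ => 0) MemLp.zero ⟨?_, ?_, ?_⟩ MemLp.zero
    (φ := fun _ _ => 0) (fun _ => IsTestFunction.zero) (by simp) (by simp [hgrad])
  · exact (locallyIntegrable_zero).locallyIntegrableOn Ω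
  · exact (locallyIntegrable_zero).locallyIntegrableOn Ω
  · simp

theorem tendsto_eLpNorm_smul_add {X F : Type*} [MeasurableSpace X] {ν : Measure X}
    [NormedAddCommGroup F] [NormedSpace ℝ F] {a b : ℕ → X → F}
    (ha : ∀ j, AEStronglyMeasurable (a j) ν) (hb : ∀ j, AEStronglyMeasurable (b j) ν)
    (ha0 : Tendsto (fun j => eLpNorm (a j) 2 ν) atTop (𝓝 0))
    (hb0 : Tendsto (fun j => eLpNorm (b j) 2 ν) atTop (𝓝 0)) (c : ℝ) :
    Tendsto (fun j => eLpNorm (c • a j + b j) 2 ν) atTop (𝓝 0) := by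
  have h : Tendsto (fun j => ‖c‖ₑ * eLpNorm (a j) 2 ν + eLpNorm (b j) 2 ν) atTop (𝓝 0) := by
    have := (ENNReal.Tendsto.const_mul (a := ‖c‖ₑ) ha0 (Or.inr (by simp))).add hb0
    simpa using this
  refine tendsto_of_tendsto_of_tendsto_of_le_of_le tendsto_const_nhds h (fun _ => zero_le)
    fun j => ?_
  refine (eLpNorm_add_le ((ha j).const_smul c) (hb j) (by norm_num)).trans ?_
  rw [eLpNorm_const_smul]

theorem MemH10.smul_add (hΩ : IsOpen Ω) {v w : E d → ℝ} (hv : MemH10 Ω v) (hw : MemH10 Ω w)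
    (c : ℝ) : MemH10 Ω (fun x => c * v x + w x) := by
  obtain ⟨hv1, φ, hφ, hφ0, hφ1⟩ := hv
  obtain ⟨hw1, ψ, hψ, hψ0, hψ1⟩ := hw
  have gv := hv1.memLp_weakGradient hΩ
  have gw := hw1.memLp_weakGradient hΩ
  refine MemH10.of_tendsto hΩ ((hv1.1.const_mul c).add hw1.1)
    (hv1.isWeakGradient.smul_add hw1.isWeakGradient c) ((gv.const_smul c).add gw)
    (fun j => (hφ j).smul_add (hψ j) c) ?_ ?_
  · refine (tendsto_eLpNorm_smul_add (fun j => (((hφ j).memLp 2).sub hv1.1).1)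
      (fun j => (((hψ j).memLp 2).sub hw1.1).1) hφ0 hψ0 c).congr fun j => ?_
    congr 1
    ext x
    simp
    ring
  · refine (tendsto_eLpNorm_smul_add (fun j => (((hφ j).memLp_gradient 2).sub gv).1)
      (fun j => (((hψ j).memLp_gradient 2).sub gw).1) hφ1 hψ1 c).congr fun j => ?_
    congr 1
    ext1 x
    simp only [Pi.add_apply, Pi.smul_apply, Pi.sub_apply]
    rw [gradient_smul_add ((hφ j).1.differentiable (by simp))
      ((hψ j).1.differentiable (by simp)), smul_sub]
    abel

/-! ### The convective term -/

theorem inner_toLp_eq_integral {X : Type*} [MeasurableSpace X] {ν : Measure X} {p q : X → ℝ}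
    (hp : MemLp p 2 ν) (hq : MemLp q 2 ν) :
    inner ℝ (hp.toLp p) (hq.toLp q) = ∫ x, p x * q x ∂ν := by
  rw [L2.inner_def]
  refine integral_congr_ae ?_
  filter_upwards [hp.coeFn_toLp, hq.coeFn_toLp] with x h1 h2
  simp [h1, h2, mul_comm]

/-- Continuity of the inner product of $L^2$ under strong convergence of both factors. -/
theorem tendsto_integral_mul {X : Type*} [MeasurableSpace X] {ν : Measure X}
    {a b : ℕ → X → ℝ} {A B : X → ℝ} (ha : ∀ j, MemLp (a j) 2 ν) (hb : ∀ j, MemLp (b j) 2 ν)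
    (hA : MemLp A 2 ν) (hB : MemLp B 2 ν)
    (haA : Tendsto (fun j => eLpNorm (a j - A) 2 ν) atTop (𝓝 0))
    (hbB : Tendsto (fun j => eLpNorm (b j - B) 2 ν) atTop (𝓝 0)) :
    Tendsto (fun j => ∫ x, a j x * b j x ∂ν) atTop (𝓝 (∫ x, A x * B x ∂ν)) := by
  have h := ((Lp.tendsto_Lp_iff_tendsto_eLpNorm'' a ha A hA).2 haA).inner
    (𝕜 := ℝ) ((Lp.tendsto_Lp_iff_tendsto_eLpNorm'' b hb B hB).2 hbB)
  simpa only [inner_toLp_eq_integral] using h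

theorem MemLp.inner_of_bound {b g : E d → E d} (hb : AEStronglyMeasurable b (volume.restrict Ω))
    {C : ℝ} (hC : ∀ᵐ x ∂volume.restrict Ω, ‖b x‖ ≤ C) (hg : MemLp g 2 (volume.restrict Ω)) :
    MemLp (fun x => inner ℝ (b x) (g x)) 2 (volume.restrict Ω) := by
  refine MemLp.of_le_mul hg (hb.inner hg.1) (c := C) ?_
  filter_upwards [hC] with x hx
  exact (norm_inner_le_norm _ _).trans (mul_le_mul_of_nonneg_right hx (norm_nonneg _))

/-- Skew-symmetry of convection: the identity is exact for the approximating test functions, and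
both factors converge in $L^2$. -/
theorem l2Inner_convection_self_eq_zero (hΩ : IsOpen Ω) {b : E d → E d}
    (hb : MemLp b ⊤ (volume.restrict Ω)) (hdiv : IsDivFree Ω b) {v : E d → ℝ}
    (hv : MemH10 Ω v) :
    l2Inner Ω (fun x => inner ℝ (b x) (weakGradient Ω v x)) v = 0 := by
  obtain ⟨hv1, φ, hφ, hφ0, hφ1⟩ := hv
  have gv := hv1.memLp_weakGradient hΩ
  obtain ⟨C, hC⟩ : ∃ C : ℝ, ∀ᵐ x ∂volume.restrict Ω, ‖b x‖ ≤ C := by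
    refine ⟨(eLpNorm b ⊤ (volume.restrict Ω)).toReal, ?_⟩
    have hfin : eLpNormEssSup b (volume.restrict Ω) ≠ ⊤ := by
      simpa using hb.2.ne
    filter_upwards [ae_le_eLpNormEssSup (f := b) (μ := volume.restrict Ω)] with x hx
    have := ENNReal.toReal_mono hfin hx
    simpa using this
  have hlim := tendsto_integral_mul
    (fun j => MemLp.inner_of_bound hb.1 hC ((hφ j).memLp_gradient 2)) (fun j => (hφ j).memLp 2)
    (MemLp.inner_of_bound hb.1 hC gv) hv1.1 ?_ hφ0
  · refine (tendsto_nhds_unique (tendsto_const_nhds.congr fun j => ?_) hlim).symm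
    -- $\varphi_j^2$ is itself a test function with gradient $2\varphi_j\nabla\varphi_j$, so every
    -- term of the sequence is zero.
    have h0 := hdiv _ (hφ j).sq
    simp only [gradient_sq ((hφ j).1.differentiable (by simp)), inner_smul_right,
      mul_assoc, integral_const_mul] at h0
    symm
    simpa [mul_comm] using h0
  · have h0 : Tendsto (fun j => ENNReal.ofReal C *
        eLpNorm (fun x => gradient (φ j) x - weakGradient Ω v x) 2 (volume.restrict Ω))
        atTop (𝓝 0) := by
      simpa using ENNReal.Tendsto.const_mul (a := ENNReal.ofReal C) hφ1 (Or.inr (by simp))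
    refine tendsto_of_tendsto_of_tendsto_of_le_of_le tendsto_const_nhds h0 (fun _ => zero_le)
      fun j => eLpNorm_le_mul_eLpNorm_of_ae_le_mul ?_ 2
    filter_upwards [hC] with x hx
    rw [Pi.sub_apply, ← inner_sub_right]
    exact (norm_inner_le_norm _ _).trans (mul_le_mul_of_nonneg_right hx (norm_nonneg _))

/-! ### A discrete energy argument -/

/-- Dropping $D$ and cancelling one factor $A_{n+1}$ gives $A_{n+1}\le A_n+\tau F_{n+1}$, which is
iterated. -/
theorem le_add_sum_of_energy_step {N : ℕ} {τ : ℝ} (hτ : 0 < τ) {A F D : ℕ → ℝ}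
    (hA : ∀ n, 0 ≤ A n) (hF : ∀ n, 0 ≤ F n) (hD : ∀ n, 0 ≤ D n)
    (h : ∀ n < N, A (n + 1) ^ 2 + τ * D (n + 1) ≤ A n * A (n + 1) + τ * (F (n + 1) * A (n + 1)))
    {m : ℕ} (hm : m ≤ N) : A m ≤ A 0 + τ * ∑ n ∈ Finset.range m, F (n + 1) := by
  induction m with
  | zero => simp
  | succ m ih =>
    have ih := ih (by omega)
    have hs := h m (by omega)
    rw [Finset.sum_range_succ, mul_add]
    -- The factor can be cancelled only when it is positive; if it is zero the bound is trivial.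
    rcases (hA (m + 1)).eq_or_lt with h0 | h0
    · have h1 := hF (m + 1)
      have h2 := hA m
      rw [← h0]
      have := mul_nonneg hτ.le h1
      linarith
    · have h1 := mul_nonneg hτ.le (hD (m + 1))
      have : A (m + 1) * A (m + 1) ≤ (A m + τ * F (m + 1)) * A (m + 1) := by nlinarith
      have := le_of_mul_le_mul_right this h0
      linarith

/-- The pointwise bound and the dissipation bound are proved separately and added, so `m` is
independent of the range of the sum. The product `N * τ` plays the role of $T$. -/
theorem sq_add_sum_le_of_energy_step {N : ℕ} {τ : ℝ} (hτ : 0 < τ) {A F D : ℕ → ℝ}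
    (hA : ∀ n, 0 ≤ A n) (hF : ∀ n, 0 ≤ F n) (hD : ∀ n, 0 ≤ D n)
    (h : ∀ n < N, A (n + 1) ^ 2 + τ * D (n + 1) ≤ A n * A (n + 1) + τ * (F (n + 1) * A (n + 1)))
    {m : ℕ} (hm : m ≤ N) :
    A m ^ 2 + 2 * τ * ∑ n ∈ Finset.range N, D (n + 1) ≤
      Real.exp 2 * (A 0 ^ 2 + τ * (N * τ) * ∑ n ∈ Finset.range N, F (n + 1) ^ 2) := by
  set S := ∑ n ∈ Finset.range N, F (n + 1) with hS
  have hS0 : 0 ≤ S := Finset.sum_nonneg fun n _ => hF _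
  have hX0 : 0 ≤ τ * S := mul_nonneg hτ.le hS0
  have hbound : ∀ n ≤ N, A n ≤ A 0 + τ * S := fun n hn => by
    refine (le_add_sum_of_energy_step hτ hA hF hD h hn).trans ?_
    have : ∑ i ∈ Finset.range n, F (i + 1) ≤ S :=
      Finset.sum_le_sum_of_subset_of_nonneg (Finset.range_subset_range.2 hn) fun i _ _ => hF _
    have := mul_le_mul_of_nonneg_left this hτ.le
    linarith
  have htel : A N ^ 2 + 2 * τ * ∑ n ∈ Finset.range N, D (n + 1) ≤
      A 0 ^ 2 + 2 * τ * ∑ n ∈ Finset.range N, F (n + 1) * (A 0 + τ * S) := by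
    have hstep : ∀ n ∈ Finset.range N, 2 * τ * D (n + 1) ≤
        2 * τ * (F (n + 1) * (A 0 + τ * S)) - (A (n + 1) ^ 2 - A n ^ 2) := fun n hn => by
      have hn := Finset.mem_range.1 hn
      have h1 := h n hn
      have h2 := mul_le_mul_of_nonneg_left
        (mul_le_mul_of_nonneg_left (hbound (n + 1) hn) (hF (n + 1))) hτ.le
      -- Young's inequality $2A_nA_{n+1}\le A_n^2+A_{n+1}^2$ turns the mixed term into a telescoping
      -- difference.
      nlinarith [sq_nonneg (A (n + 1) - A n)]
    have := Finset.sum_le_sum hstep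
    rw [Finset.sum_sub_distrib, Finset.sum_range_sub (fun n => A n ^ 2), ← Finset.mul_sum,
      ← Finset.mul_sum] at this
    linarith
  rw [← Finset.sum_mul] at htel
  have hCS : S ^ 2 ≤ N * ∑ n ∈ Finset.range N, F (n + 1) ^ 2 := by
    simpa using sq_sum_le_card_mul_sum_sq (s := Finset.range N) (f := fun n => F (n + 1))
  set Q := ∑ n ∈ Finset.range N, F (n + 1) ^ 2
  have hX : (τ * S) ^ 2 ≤ τ * (N * τ) * Q := by
    have := mul_le_mul_of_nonneg_left hCS (sq_nonneg τ)
    nlinarith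
  have hm2 : A m ^ 2 ≤ (A 0 + τ * S) ^ 2 := pow_le_pow_left₀ (hA m) (hbound m hm) 2
  have he : (5 : ℝ) ≤ Real.exp 2 := by
    have h1 := Real.exp_one_gt_d9
    have : Real.exp 2 = Real.exp 1 * Real.exp 1 := by rw [← Real.exp_add]; norm_num
    nlinarith
  -- With $X=\tau S$ the two bounds add up to $2A_0^2+4A_0X+3X^2$, and $4A_0X\le 2A_0^2+2X^2$ gives
  -- at most $4A_0^2+5X^2$.
  have hfin : A m ^ 2 + 2 * τ * ∑ n ∈ Finset.range N, D (n + 1) ≤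
      5 * (A 0 ^ 2 + τ * (N * τ) * Q) := by
    nlinarith [sq_nonneg (A 0 * 2 - 2 * (τ * S)), sq_nonneg (A N),
      sq_nonneg (A 0 * 2 - (τ * S))]
  refine hfin.trans (mul_le_mul_of_nonneg_right he ?_)
  nlinarith [sq_nonneg (A 0), sq_nonneg (τ * S)]

/-! ### Inner products and norms -/

theorem l2Inner_self_nonneg (v : E d → ℝ) : 0 ≤ l2Inner Ω v v :=
  integral_nonneg fun _ => mul_self_nonneg _

theorem l2Norm_sq (v : E d → ℝ) : l2Norm Ω v ^ 2 = l2Inner Ω v v :=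
  Real.sq_sqrt (l2Inner_self_nonneg v)

theorem l2Norm_nonneg (v : E d → ℝ) : 0 ≤ l2Norm Ω v := Real.sqrt_nonneg _

theorem h1Seminorm_sq (v : E d → ℝ) :
    h1Seminorm Ω v ^ 2 = l2InnerVec Ω (weakGradient Ω v) (weakGradient Ω v) :=
  Real.sq_sqrt (integral_nonneg fun _ => real_inner_self_nonneg)

theorem l2Inner_le_l2Norm_mul {v w : E d → ℝ} (hv : MemLp v 2 (volume.restrict Ω))
    (hw : MemLp w 2 (volume.restrict Ω)) : l2Inner Ω v w ≤ l2Norm Ω v * l2Norm Ω w := by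
  have h := real_inner_le_norm (hv.toLp v) (hw.toLp w)
  rwa [norm_eq_sqrt_real_inner, norm_eq_sqrt_real_inner, inner_toLp_eq_integral,
    inner_toLp_eq_integral, inner_toLp_eq_integral] at h

theorem l2Inner_sub_div_left {v w z : E d → ℝ} (hv : MemLp v 2 (volume.restrict Ω))
    (hw : MemLp w 2 (volume.restrict Ω)) (hz : MemLp z 2 (volume.restrict Ω)) (τ : ℝ) :
    l2Inner Ω (fun x => (v x - w x) / τ) z = (l2Inner Ω v z - l2Inner Ω w z) / τ := by
  have h1 : Integrable (fun x => v x * z x) (volume.restrict Ω) := hv.integrable_mul hz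
  have h2 : Integrable (fun x => w x * z x) (volume.restrict Ω) := hw.integrable_mul hz
  rw [l2Inner, l2Inner, l2Inner, ← integral_sub h1 h2, ← integral_div]
  refine integral_congr_ae (Eventually.of_forall fun x => ?_)
  simp only
  ring

/-! ### The finite element space -/

theorem Cell.IsLocalPoly.smul_add {K : Cell d} {k : ℕ} {v w : E d → ℝ} (hv : K.IsLocalPoly k v)
    (hw : K.IsLocalPoly k w) (c : ℝ) : K.IsLocalPoly k (fun x => c * v x + w x) := by
  obtain ⟨p, hp, hpv⟩ := hv
  obtain ⟨q, hq, hqw⟩ := hw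
  refine ⟨c • p + q, add_mem (Submodule.smul_mem _ c hp) hq, fun x hx => ?_⟩
  simp [hpv x hx, hqw x hx]

theorem CellShape.vertexShape_nonneg (S : CellShape) (a : Fin d → ℕ) {x : E d}
    (hx : x ∈ S.refCell d) : 0 ≤ S.vertexShape d a x := by
  cases S with
  | simplex =>
    simp only [vertexShape]
    split_ifs
    · exact sub_nonneg.2 hx.2
    · exact Finset.sum_nonneg fun i _ => mul_nonneg (Nat.cast_nonneg _) (hx.1 i)
  | cube =>
    refine Finset.prod_nonneg fun i _ => ?_
    split_ifs
    · exact sub_nonneg.2 (hx i).2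
    · exact (hx i).1

namespace Mesh

variable (P : Mesh d Ω) (k : ℕ)

theorem vertexDiam_nonneg (y : E d) : 0 ≤ P.vertexDiam y :=
  div_nonneg (Finset.sum_nonneg fun _ _ => Metric.diam_nonneg) (Nat.cast_nonneg _)

/-- Each value is a combination of averaged diameters whose coefficients are shape functions
evaluated inside the reference cell, hence nonnegative. -/
theorem meshFun_nonneg (x : E d) : 0 ≤ P.meshFun x := by
  unfold meshFun
  split_ifs with h
  · refine Finset.sum_nonneg fun a _ => mul_nonneg ?_ (P.vertexDiam_nonneg _)
    obtain ⟨y, hy, hyx⟩ := h.choose_spec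
    refine CellShape.vertexShape_nonneg _ a ?_
    rwa [← (P.cell h.choose).map.symm_apply_eq.2 hyx.symm] at hy
  · exact le_rfl

theorem zero_mem_feSpace (hΩ : IsOpen Ω) : (fun _ : E d => (0 : ℝ)) ∈ P.feSpace k :=
  ⟨continuousOn_const, fun _ => ⟨0, zero_mem _, fun _ _ => by simp⟩, MemH10.zero hΩ⟩

variable {P k} in
theorem feSpace_smul_add (hΩ : IsOpen Ω) {v w : E d → ℝ} (hv : v ∈ P.feSpace k)
    (hw : w ∈ P.feSpace k) (c : ℝ) : (fun x => c * v x + w x) ∈ P.feSpace k :=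
  ⟨(continuousOn_const.mul hv.1).add hw.1, fun i => (hv.2.1 i).smul_add (hw.2.1 i) c,
    hv.2.2.smul_add hΩ hw.2.2 c⟩

theorem lagrangeBasis_mem_feSpace (hΩ : IsOpen Ω) (x : E d) :
    P.lagrangeBasis k x ∈ P.feSpace k := by
  unfold lagrangeBasis
  split_ifs with h
  · exact h.choose_spec.1
  · exact P.zero_mem_feSpace k hΩ

theorem sum_lagrangeBasis_mem_feSpace (hΩ : IsOpen Ω) (c : E d → ℝ) (s : Finset (E d)) :
    (fun y => ∑ x ∈ s, c x * P.lagrangeBasis k x y) ∈ P.feSpace k := by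
  classical
  induction s using Finset.induction_on with
  | empty => simpa using P.zero_mem_feSpace k hΩ
  | insert a s ha ih =>
    simp only [Finset.sum_insert ha]
    exact feSpace_smul_add hΩ (P.lagrangeBasis_mem_feSpace k hΩ a) ih _

theorem constrained_mem_feSpace (hΩ : IsOpen Ω) (κ : ℝ) (v : E d → ℝ) :
    P.constrained k κ v ∈ P.feSpace k :=
  P.sum_lagrangeBasis_mem_feSpace k hΩ _ _

open Classical in
/-- Either `x` carries a nodal basis function, or the function attached to it is zero. -/
theorem lagrangeBasis_apply_or (x : E d) :
    (∀ y ∈ P.internalNodes k, P.lagrangeBasis k x y = if y = x then 1 else 0) ∨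
      P.lagrangeBasis k x = 0 := by
  unfold lagrangeBasis
  split_ifs with h
  · exact Or.inl h.choose_spec.2
  · exact Or.inr rfl

/-! ### Nodal values and the sign of the stabilisation -/

variable {P k} in
-- The factor `P.lagrangeBasis k y y` is kept because it is $0$ instead of $1$ when `lagrangeBasis`
-- takes its default value. Treating both cases avoids proving that the nodal basis exists.
theorem sum_lagrangeBasis_apply {y : E d} (hy : y ∈ P.internalNodes k) (c : E d → ℝ) :
    ∑ x ∈ P.internalNodes k, c x * P.lagrangeBasis k x y = c y * P.lagrangeBasis k y y := by
  refine Finset.sum_eq_single_of_mem y hy fun x _ hxy => ?_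
  rcases P.lagrangeBasis_apply_or k x with h | h
  · rw [h y hy, if_neg hxy.symm, mul_zero]
  · rw [h, Pi.zero_apply, mul_zero]

variable {P k} in
theorem lagrangeBasis_self_eq_one_or_zero {y : E d} (hy : y ∈ P.internalNodes k) :
    P.lagrangeBasis k y y = 1 ∨ P.lagrangeBasis k y = 0 := by
  rcases P.lagrangeBasis_apply_or k y with h | h
  · exact Or.inl (by rw [h y hy, if_pos rfl])
  · exact Or.inr h

/-- A negative nodal value is truncated to $v^+=0$. A nonnegative one satisfies $0\le v^+\le v$,
whatever the sign of `κ`. -/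
theorem complementary_mul_constrained_nonneg (κ : ℝ) (v : E d → ℝ) {y : E d}
    (hy : y ∈ P.internalNodes k) :
    0 ≤ P.complementary k κ v y * P.constrained k κ v y := by
  rw [complementary, constrained,
    sum_lagrangeBasis_apply hy fun x => max 0 (min (v x) κ)]
  rcases lagrangeBasis_self_eq_one_or_zero hy with h | h
  · rw [h, mul_one]
    rcases le_total (v y) 0 with h0 | h0
    · rw [max_eq_left ((min_le_left _ _).trans h0), mul_zero]
    · refine mul_nonneg (sub_nonneg.2 (max_le h0 (min_le_left _ _))) (le_max_left _ _)
  · simp [h]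

theorem s_complementary_constrained_nonneg {α ε μ τ : ℝ} (κ : ℝ) (hα : 0 ≤ α) (hε : 0 ≤ ε)
    (hμ : 0 ≤ μ) (hτ : 0 ≤ τ) (b : E d → E d) (w : E d → ℝ) :
    0 ≤ P.s k α ε μ τ b (P.complementary k κ w) (P.constrained k κ w) := by
  refine mul_nonneg hα (Finset.sum_nonneg fun x hx => ?_)
  rw [mul_assoc]
  refine mul_nonneg ?_ (P.complementary_mul_constrained_nonneg k κ w hx)
  have h := P.meshFun_nonneg x
  have h' : 0 ≤ supNorm (volume.restrict (P.patch x)) b := ENNReal.toReal_nonneg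
  positivity

theorem J_self_nonneg {γ : ℝ} (hγ : 0 ≤ γ) (b : E d → E d) (v : E d → ℝ) :
    0 ≤ P.J γ b v v := by
  refine mul_nonneg hγ (Finset.sum_nonneg fun p _ => integral_nonneg fun x => ?_)
  exact mul_nonneg (mul_nonneg ENNReal.toReal_nonneg (sq_nonneg _)) real_inner_self_nonneg

/-- The constraint does not change an interpolant of data within the bounds. -/
theorem constrained_eqOn_interp {κ : ℝ} {u0 w : E d → ℝ}
    (hu0 : ∀ x ∈ Ω, 0 ≤ u0 x ∧ u0 x ≤ κ) (hw : Set.EqOn w (P.interp k u0) (closure Ω)) :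
    Set.EqOn (P.constrained k κ w) w (closure Ω) := by
  intro y hy
  rw [hw hy]
  refine Finset.sum_congr rfl fun x hx => ?_
  rcases lagrangeBasis_self_eq_one_or_zero hx with h | h
  · have hxΩ : x ∈ Ω := by
      classical
      unfold internalNodes at hx
      exact (Finset.mem_filter.1 hx).2
    -- The interpolant takes the value of `u0` at the node, which already lies in $[0,\kappa]$, so
    -- the truncation acts as the identity.
    have hwx : w x = u0 x := by
      rw [hw (subset_closure hxΩ), interp, sum_lagrangeBasis_apply hx, h, mul_one]
    rw [hwx, min_eq_left (hu0 x hxΩ).2, max_eq_right (hu0 x hxΩ).1]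
  · simp [h]

end Mesh

theorem aForm_self (hΩ : IsOpen Ω) {ε μ : ℝ} {b : E d → E d}
    (hb : MemLp b ⊤ (volume.restrict Ω)) (hdiv : IsDivFree Ω b) {v : E d → ℝ}
    (hv : MemH10 Ω v) :
    aForm Ω ε μ b v v = ε * h1Seminorm Ω v ^ 2 + μ * l2Norm Ω v ^ 2 := by
  rw [aForm, l2Inner_convection_self_eq_zero hΩ hb hdiv hv, h1Seminorm_sq, l2Norm_sq, add_zero]

end BPFem

/-! ### The stability estimate -/

theorem mainTheorem3 {d : ℕ} (hd : d = 2 ∨ d = 3) {Ω : Set (BPFem.E d)}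
    (hΩ : IsOpen Ω) (hΩb : Bornology.IsBounded Ω) (hΩL : BPFem.IsLipschitzDomain Ω)
    (P : BPFem.Mesh d Ω) (k : ℕ) (hk : 1 ≤ k) (N : ℕ) (hN : 1 ≤ N)
    (T ε μ γ α : ℝ) (hT : 0 < T) (hε : 0 < ε) (hμ : 0 ≤ μ) (hγ : 0 ≤ γ) (hα : 0 < α)
    (κ : ℝ → ℝ) (hκ : ∀ t ∈ Set.Icc 0 T, 0 < κ t)
    (β : ℝ → BPFem.E d → BPFem.E d)
    (hβ : ∀ n ∈ Finset.Icc 1 N, BPFem.MemW1Inf Ω (β (n * (T / N))) ∧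
      ContinuousOn (β (n * (T / N))) (closure Ω) ∧ BPFem.IsDivFree Ω (β (n * (T / N))))
    (f : ℝ → BPFem.E d → ℝ)
    (hf : ∀ n ∈ Finset.range (N + 1), MemLp (f (n * (T / N))) 2 (volume.restrict Ω))
    (u0 : BPFem.E d → ℝ) (hu0c : ContinuousOn u0 (closure Ω)) (hu0H : BPFem.MemH10 Ω u0)
    (hu0 : ∀ x ∈ Ω, 0 ≤ u0 x ∧ u0 x ≤ κ 0)
    (u : ℕ → BPFem.E d → ℝ)
    (hu : BPFem.SolvesEuler P k N T ε μ γ α κ β f u0 u) :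
    let Δt : ℝ := T / N
    let t : ℕ → ℝ := fun n => n * Δt
    let up : ℕ → BPFem.E d → ℝ := fun n => P.constrained k (κ (t n)) (u n)
    (Finset.Icc 1 N).sup' (Finset.nonempty_Icc.2 hN) (fun m => BPFem.l2Norm Ω (up m) ^ 2)
        + 2 * Δt * ∑ n ∈ Finset.Icc 1 N,
          (ε * BPFem.h1Seminorm Ω (up n) ^ 2 + μ * BPFem.l2Norm Ω (up n) ^ 2
            + P.J γ (β (t n)) (up n) (up n))
      ≤ Real.exp 2 * (BPFem.l2Norm Ω (u 0) ^ 2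
          + Δt * T * ∑ n ∈ Finset.range (N + 1), BPFem.l2Norm Ω (f (t n)) ^ 2) := by
  intro Δt t up
  have hN0 : (0 : ℝ) < N := by exact_mod_cast hN
  have hτ : 0 < Δt := div_pos hT hN0
  have hNτ : N * Δt = T := mul_div_cancel₀ T hN0.ne'
  obtain ⟨hinit, hstep⟩ := hu
  have hmem : ∀ n, up n ∈ P.feSpace k := fun n => P.constrained_mem_feSpace k hΩ _ _
  have hL2 : ∀ n, MemLp (up n) 2 (volume.restrict Ω) := fun n => (hmem n).2.2.1.1
  have hup0 : BPFem.l2Norm Ω (up 0) = BPFem.l2Norm Ω (u 0) := by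
    have h0 : Set.EqOn (up 0) (u 0) (closure Ω) :=
      P.constrained_eqOn_interp k (κ := κ (t 0)) (by simpa [t] using hu0) hinit
    have : BPFem.l2Inner Ω (up 0) (up 0) = BPFem.l2Inner Ω (u 0) (u 0) :=
      setIntegral_congr_fun hΩ.measurableSet fun x hx => by simp [h0 (subset_closure hx)]
    rw [BPFem.l2Norm, BPFem.l2Norm, this]
  set D : ℕ → ℝ := fun n => ε * BPFem.h1Seminorm Ω (up n) ^ 2 + μ * BPFem.l2Norm Ω (up n) ^ 2
    + P.J γ (β (t n)) (up n) (up n) with hD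
  have hD0 : ∀ n, 0 ≤ D n := fun n =>
    add_nonneg (add_nonneg (mul_nonneg hε.le (sq_nonneg _)) (mul_nonneg hμ (sq_nonneg _)))
      (P.J_self_nonneg hγ _ _)
  have henergy : ∀ n < N, BPFem.l2Norm Ω (up (n + 1)) ^ 2 + Δt * D (n + 1) ≤
      BPFem.l2Norm Ω (up n) * BPFem.l2Norm Ω (up (n + 1))
        + Δt * (BPFem.l2Norm Ω (f (t (n + 1))) * BPFem.l2Norm Ω (up (n + 1))) := by
    intro n hn
    have hn1 : n + 1 ∈ Finset.Icc 1 N := Finset.mem_Icc.2 ⟨by omega, hn⟩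
    -- The energy identity comes from testing with the constrained part of the solution itself.
    have heq := (hstep (n + 1) hn1).2 (up (n + 1)) (hmem _)
    obtain ⟨hβ1, -, hβ2⟩ := hβ (n + 1) hn1
    have ha := BPFem.aForm_self (ε := ε) (μ := μ) hΩ hβ1.1 hβ2 (hmem (n + 1)).2.2
    have hs := P.s_complementary_constrained_nonneg k (κ (t (n + 1))) hα.le hε.le hμ hτ.le
      (β (t (n + 1))) (u (n + 1))
    have hd := BPFem.l2Inner_sub_div_left (hL2 (n + 1)) (hL2 n) (hL2 (n + 1)) Δt
    have hcs1 := BPFem.l2Inner_le_l2Norm_mul (hL2 n) (hL2 (n + 1))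
    have hcs2 := BPFem.l2Inner_le_l2Norm_mul
      (hf (n + 1) (Finset.mem_range.2 (by omega))) (hL2 (n + 1))
    -- The previous index `n + 1 - 1` reduces to `n`, so the old value is truncated with the bound
    -- at its own time level.
    change BPFem.l2Inner Ω (fun x => (up (n + 1) x - up n x) / Δt) (up (n + 1))
      + (BPFem.aForm Ω ε μ (β (t (n + 1))) (up (n + 1)) (up (n + 1))
        + P.J γ (β (t (n + 1))) (up (n + 1)) (up (n + 1))
        + P.s k α ε μ Δt (β (t (n + 1))) (P.complementary k (κ (t (n + 1))) (u (n + 1)))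
          (up (n + 1)))
      = BPFem.l2Inner Ω (f (t (n + 1))) (up (n + 1)) at heq
    change BPFem.aForm Ω ε μ (β (t (n + 1))) (up (n + 1)) (up (n + 1)) = _ at ha
    change BPFem.l2Inner Ω (f (t (n + 1))) (up (n + 1)) ≤
      BPFem.l2Norm Ω (f (t (n + 1))) * BPFem.l2Norm Ω (up (n + 1)) at hcs2
    change 0 ≤ P.s k α ε μ Δt (β (t (n + 1))) (P.complementary k (κ (t (n + 1))) (u (n + 1)))
      (up (n + 1)) at hs
    rw [hd, ha, ← BPFem.l2Norm_sq] at heq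
    have hle : (BPFem.l2Norm Ω (up (n + 1)) ^ 2 - BPFem.l2Inner Ω (up n) (up (n + 1))) / Δt ≤
        BPFem.l2Norm Ω (f (t (n + 1))) * BPFem.l2Norm Ω (up (n + 1)) - D (n + 1) := by
      simp only [hD]
      linarith
    rw [div_le_iff₀ hτ] at hle
    linarith
  have hshift : ∀ g : ℕ → ℝ, ∑ n ∈ Finset.Icc 1 N, g n = ∑ n ∈ Finset.range N, g (n + 1) :=
    fun g => by
      rw [Finset.range_eq_Ico, Finset.sum_Ico_add' g 0 N 1]
      rfl
  obtain ⟨m, hm, hmax⟩ := Finset.exists_mem_eq_sup' (Finset.nonempty_Icc.2 hN)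
    fun m => BPFem.l2Norm Ω (up m) ^ 2
  rw [hmax, hshift]
  refine (BPFem.sq_add_sum_le_of_energy_step hτ (fun n => BPFem.l2Norm_nonneg (up n))
    (fun n => BPFem.l2Norm_nonneg (f (t n))) hD0 henergy (Finset.mem_Icc.1 hm).2).trans ?_
  -- The energy argument uses only $f^1,\dots,f^N$; the term with $f^0$ is split off and added as a
  -- nonnegative surplus.
  rw [hNτ, hup0, Finset.sum_range_succ' _ N]
  have hf0 : 0 ≤ BPFem.l2Norm Ω (f (t 0)) ^ 2 := sq_nonneg _
  gcongr
  linarith
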